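/- Corollary 1.2. Interior Lipschitz estimate in the last variable. Let $m\ge 1$, let $N_1,\dots,N_{m-1}\ge 1$ be integers and $n=N_1+\dots+N_{m-1}+1$. Write $x=(X_1,\dots,X_{m-1},x_n)\in\mathbb R^n$, where $X_i\in\mathbb R^{N_i}$ is the $i$-th group of consecutive coordinates, and for $y\in\mathbb R^{N_i}$ let $y^{(i)}\in\mathbb R^n$ be the vector whose $i$-th group of coordinates is $y$ and whose other coordinates vanish. For $s\in(0,1]$ let $$(-\Delta_{X_i})^{s}u(x)=\begin{cases}-\Delta_{X_i}u(x)=-\sum_{x_j\in X_i}\partial^2_{x_j}u(x)&\text{if }s=1,\\[4pt] \displaystyle c_{N_i,s}\int_{\mathbb R^{N_i}}\frac{2u(x)-u(x+y^{(i)})-u(x-y^{(i)})}{|y|^{N_i+2s}}\,dy&\text{if }s\in(0,1),\end{cases}\qquad c_{N,s}=\frac{2^{2s-1}\,\Gamma(s+\frac N2)}{\pi^{N/2}\,|\Gamma(-s)|}.$$ Let $s_1,\dots,s_{m-1}\in(0,1]$, $a_1,\dots,a_{m-1}\ge 0$, $a_m=a>0$, and $$L=\sum_{i=1}^{m-1}a_i(-\Delta_{X_i})^{s_i}-a\,\partial_{x_n}^2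 .$$ Let $B_r$ be the open Euclidean ball of $\mathbb R^n$ with centre $0$ and radius $r$. Then there is a constant $C>0$, depending only on $a_1,\dots,a_m$, $s_1,\dots,s_{m-1}$ and $N_1,\dots,N_{m-1}$, such that, whenever $u:\mathbb R^n\to\mathbb R$ is a classical solution of $Lu=f$ in $B_1$, $$\|\partial_{x_n}u\|_{L^\infty(B_{1/2})}\le C\big(\|f\|_{L^\infty(B_1)}+\|u\|_{L^\infty(\mathbb R^n)}\big).$$ Here $u$ is a classical solution in $B_1$ if it is continuous in $B_1$, each term of $L$ with non-zero coefficient can be computed at every point of $B_1$ (for a second-order term, $u$ is twice differentiable in each of the variables involved; for a fractional term, the integral converges absolutely), and $Lu(x)=f(x)$ for every $x\in B_1$. The functions are defined pointwise and $\|g\|_{L^\infty(\Omega)}=\sup_{\Omega}|g|\in[0,\infty]$; for $g$ continuous in an open set $\Omega$ this is the usual essential-supremum norm. -/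

import Mathlib

open MeasureTheory

noncomputable section

namespace AnisotropicNonlocal

/-- The ambient space `ℝⁿ` with its Euclidean norm, where `n = N₁ + ⋯ + N_k + 1`: there are `k`
groups of variables, the `i`-th one with `N i` coordinates, followed by one last coordinate
(so the number of groups including the last, one-dimensional one is `m = k + 1`). -/
abbrev Space {k : ℕ} (N : Fin k → ℕ) : Type := EuclideanSpace ℝ (Fin ((∑ i, N i) + 1))

/-- The position among the `n` coordinates of the `j`-th coordinate of the `i`-th group
(the groups are consecutive; with indices starting from `0` it is `N₁ + ⋯ + N_{i-1} + j`). -/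
def groupIndex {k : ℕ} (N : Fin k → ℕ) (i : Fin k) (j : Fin (N i)) : Fin ((∑ i, N i) + 1) :=
  (finSigmaFinEquiv (⟨i, j⟩ : (i : Fin k) × Fin (N i))).castSucc

/-- The vector `e_j` of the Euclidean basis of `ℝⁿ`. -/
def basisVec {k : ℕ} (N : Fin k → ℕ) (j : Fin ((∑ i, N i) + 1)) : Space N :=
  EuclideanSpace.single j (1 : ℝ)

/-- The increment `y⁽ⁱ⁾ ∈ ℝⁿ` induced by `y ∈ ℝ^{N_i}` in the `i`-th group of coordinates. -/
def increment {k : ℕ} (N : Fin k → ℕ) (i : Fin k) (y : EuclideanSpace ℝ (Fin (N i))) : Space N :=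
  ∑ j, y j • basisVec N (groupIndex N i j)

/-- The partial derivative `∂_{x_j} u (x)`. -/
def partialDeriv {k : ℕ} (N : Fin k → ℕ) (j : Fin ((∑ i, N i) + 1)) (u : Space N → ℝ)
    (x : Space N) : ℝ :=
  lineDeriv ℝ u x (basisVec N j)

/-- `u` is twice differentiable in the variable `x_j` at every point of the open set `Ω`. -/
def TwiceDiffInVar {k : ℕ} (N : Fin k → ℕ) (j : Fin ((∑ i, N i) + 1)) (u : Space N → ℝ)
    (Ω : Set (Space N)) : Prop :=
  ∀ x ∈ Ω, LineDifferentiableAt ℝ u x (basisVec N j) ∧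
    LineDifferentiableAt ℝ (partialDeriv N j u) x (basisVec N j)

/-- The normalization constant `c_{N,s}` of the fractional Laplacian. -/
def fracConst (N : ℕ) (s : ℝ) : ℝ :=
  (2 : ℝ) ^ (2 * s - 1) * Real.Gamma (s + (N : ℝ) / 2) /
    (Real.pi ^ ((N : ℝ) / 2) * |Real.Gamma (-s)|)

/-- The integrand of the `s`-Laplacian in the `i`-th group of variables at `x`. Here `‖y‖` is also
the norm of `y⁽ⁱ⁾` in `ℝⁿ`. -/
def fracIntegrand {k : ℕ} (N : Fin k → ℕ) (i : Fin k) (s : ℝ) (u : Space N → ℝ) (x : Space N)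
    (y : EuclideanSpace ℝ (Fin (N i))) : ℝ :=
  (2 * u x - u (x + increment N i y) - u (x - increment N i y)) / ‖y‖ ^ ((N i : ℝ) + 2 * s)

open Classical in
/-- The (possibly fractional) `s`-Laplacian `(-Δ_{X_i})^s u (x)` in the `i`-th group of
variables, for `s ∈ (0,1]`. -/
def groupLaplacian {k : ℕ} (N : Fin k → ℕ) (i : Fin k) (s : ℝ) (u : Space N → ℝ)
    (x : Space N) : ℝ :=
  if s = 1 then
    -∑ j, partialDeriv N (groupIndex N i j) (partialDeriv N (groupIndex N i j) u) x
  else fracConst (N i) s * ∫ y, fracIntegrand N i s u x y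

/-- `(-Δ_{X_i})^s u` can be computed pointwise in the open set `Ω`: the pure second derivatives
exist if `s = 1`, and the integral converges (absolutely) if `s < 1`. -/
def GroupLaplacianDefinedOn {k : ℕ} (N : Fin k → ℕ) (i : Fin k) (s : ℝ) (u : Space N → ℝ)
    (Ω : Set (Space N)) : Prop :=
  (s = 1 → ∀ j, TwiceDiffInVar N (groupIndex N i j) u Ω) ∧
    (s ≠ 1 → ∀ x ∈ Ω, Integrable (fracIntegrand N i s u x))

/-- The operator `L = ∑_{i<m} a_i (-Δ_{X_i})^{s_i} - a ∂²_{x_n}`; `aLast` is `a = a_m`. -/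
def opL {k : ℕ} (N : Fin k → ℕ) (s a : Fin k → ℝ) (aLast : ℝ) (u : Space N → ℝ)
    (x : Space N) : ℝ :=
  ∑ i, a i * groupLaplacian N i (s i) u x -
    aLast * partialDeriv N (Fin.last _) (partialDeriv N (Fin.last _) u) x

/-- `u : ℝⁿ → ℝ` is a classical solution of `L u = f` in the open set `Ω`: it is continuous in `Ω`,
every term that really occurs in `L` (i.e. with non-zero coefficient) can be computed pointwise
in `Ω`, and the equation holds at every point of `Ω`. -/
structure IsSolution {k : ℕ} (N : Fin k → ℕ) (s a : Fin k → ℝ) (aLast : ℝ)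
    (u f : Space N → ℝ) (Ω : Set (Space N)) : Prop where
  continuousOn : ContinuousOn u Ω
  groupDefined : ∀ i, a i ≠ 0 → GroupLaplacianDefinedOn N i (s i) u Ω
  lastDefined : TwiceDiffInVar N (Fin.last _) u Ω
  equation : ∀ x ∈ Ω, opL N s a aLast u x = f x

/-- The `L^∞(Ω)` norm of a function defined at every point, as its supremum norm with values in
`[0,∞]`. -/
def supNorm {k : ℕ} {N : Fin k → ℕ} (g : Space N → ℝ) (Ω : Set (Space N)) : ENNReal :=
  ⨆ x ∈ Ω, ‖g x‖ₑ

/-- For functions that are continuous in an open set, `supNorm` is the essential-supremum norm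
with respect to Lebesgue measure. -/
theorem supNorm_eq_eLpNorm {k : ℕ} {N : Fin k → ℕ} (g : Space N → ℝ) (Ω : Set (Space N))
    (hΩ : IsOpen Ω) (hg : ContinuousOn g Ω) :
    supNorm g Ω = eLpNorm g ⊤ (volume.restrict Ω) := by
  rw [eLpNorm_exponent_top]
  apply le_antisymm
  · refine iSup₂_le fun x hx => ?_
    by_contra! hlt
    have hopen : IsOpen (Ω ∩ (fun y => ‖g y‖ₑ) ⁻¹'
        Set.Ioi (eLpNormEssSup g (volume.restrict Ω))) :=
      hg.enorm.isOpen_inter_preimage hΩ isOpen_Ioi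
    have hpos := hopen.measure_pos volume ⟨x, hx, hlt⟩
    have hae := ae_le_eLpNormEssSup (f := g) (μ := volume.restrict Ω)
    rw [ae_restrict_iff' hΩ.measurableSet, ae_iff] at hae
    refine hpos.ne' (measure_mono_null ?_ hae)
    rintro y ⟨hy, hy'⟩ h
    exact absurd (h hy) (not_le.mpr hy')
  · refine essSup_le_of_ae_le _ ?_
    filter_upwards [ae_restrict_mem hΩ.measurableSet] with x hx
    exact le_iSup₂ (f := fun x (_ : x ∈ Ω) => ‖g x‖ₑ) x hx

end AnisotropicNonlocal

end

noncomputable section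

namespace AnisotropicNonlocal

open Filter Topology Set

/-! Fix x₀ in the half ball and let v(x,t) = (u(x + t e_n) - u(x - t e_n)) / 2. Its second
difference in t is half the difference of the second differences of u along e_n at p = x + t e_n and
q = x - t e_n, so a maximum principle for v in (x,t) needs only the equation at p and q, and f is
never differentiated.

Compare v with M bump(x - x₀) + B t(1 - t), where |u| ≤ M and |f| ≤ K. A positive maximum of the
difference over a small cylinder is interior and global in x, as the nonlocal terms require. There,
maximality in x bounds the drop of the other Laplacians from p to q by a multiple of M, and
concavity in t gives ∂ₙ²u(p) - ∂ₙ²u(q) ≤ -4B. Subtracting the two equations yields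
`IsSolution.barrier_coefficient_le`, which fails for B = C(K + M) with C large. Hence v(x₀,t) ≤ B
t(1 - t); dividing by t and letting t → 0 bounds ∂ₙu(x₀) above, and -u gives the lower bound. -/

/-- A second-order Taylor coefficient is bounded by any bound on the second differences. -/
theorem second_deriv_le_of_second_difference_le {g g' : ℝ → ℝ} {g'' c : ℝ}
    (hg : ∀ᶠ h in 𝓝 0, HasDerivAt g (g' h) h) (hg' : HasDerivAt g' g'' 0)
    (hc : ∀ᶠ h in 𝓝 (0 : ℝ), g h + g (-h) - 2 * g 0 ≤ c * h ^ 2) : g'' ≤ c := by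
  by_contra! hlt
  -- Subtracting d h² leaves a positive second derivative at 0, hence a local minimum there, while
  -- the assumed bound with c < d forces a strict maximum.
  obtain ⟨d, hcd, hdg⟩ := exists_between hlt
  have hneg : Tendsto (fun h : ℝ => -h) (𝓝 0) (𝓝 0) := by
    simpa using (continuous_neg (G := ℝ)).tendsto 0
  have hG : ∀ᶠ h in 𝓝 (0 : ℝ), HasDerivAt (fun h => g h + g (-h) - d * h ^ 2)
      (g' h - g' (-h) - 2 * d * h) h := by
    filter_upwards [hg, hneg.eventually hg] with h h1 h2
    have h3 := ((h1.add (h2.comp h (hasDerivAt_neg h))).sub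
      (((hasDerivAt_id h).pow 2).const_mul d))
    refine h3.congr_deriv ?_
    simp
    ring
  have hdG : deriv (fun h => g h + g (-h) - d * h ^ 2) =ᶠ[𝓝 0]
      fun h => g' h - g' (-h) - 2 * d * h := by
    filter_upwards [hG] with h hh using hh.deriv
  have hG' : HasDerivAt (fun h => g' h - g' (-h) - 2 * d * h) (2 * g'' - 2 * d) 0 := by
    have h2 : HasDerivAt g' g'' (-0) := by simpa using hg'
    have h3 := (hg'.sub (h2.comp 0 (hasDerivAt_neg 0))).sub
      ((hasDerivAt_id (0 : ℝ)).const_mul (2 * d))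
    refine h3.congr_deriv ?_
    ring
  have hmin : IsLocalMin (fun h => g h + g (-h) - d * h ^ 2) 0 := by
    apply isLocalMin_of_deriv_deriv_pos
    · rw [hdG.deriv_eq, hG'.deriv]
      linarith
    · rw [hdG.eq_of_nhds]
      simp
    · exact hG.self_of_nhds.continuousAt
  have key : ∀ᶠ h in 𝓝 (0 : ℝ), h = 0 := by
    filter_upwards [hmin, hc] with h h1 h2
    simp only [neg_zero] at h1
    by_contra hne
    have : 0 < h ^ 2 := by positivity
    nlinarith
  obtain ⟨ε, hε, hball⟩ := Metric.eventually_nhds_iff.1 key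
  have := hball (y := ε / 2) (by simp [abs_of_pos hε, hε])
  linarith

/-! ### The spatial barrier -/

/-- The bounded smooth profile `17 |x|² / (1 + |x|²)`, which vanishes at the origin and is at
least `1` outside the ball of radius `1/4`. -/
def bump {E : Type*} [NormedAddCommGroup E] (x : E) : ℝ := 17 * (1 - 1 / (1 + ‖x‖ ^ 2))

section Bump

variable {E : Type*} [NormedAddCommGroup E]

theorem bump_zero : bump (0 : E) = 0 := by simp [bump]

theorem bump_nonneg (x : E) : 0 ≤ bump x := by
  have : 1 / (1 + ‖x‖ ^ 2) ≤ 1 := by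
    rw [div_le_one (by positivity)]
    nlinarith [sq_nonneg ‖x‖]
  unfold bump
  linarith

theorem one_le_bump {x : E} (hx : 1 / 4 ≤ ‖x‖) : 1 ≤ bump x := by
  have : 1 / (1 + ‖x‖ ^ 2) ≤ 16 / 17 := by
    rw [div_le_div_iff₀ (by positivity) (by norm_num)]
    nlinarith
  unfold bump
  linarith

theorem continuous_bump : Continuous (bump : E → ℝ) := by
  unfold bump
  have h : ∀ x : E, 1 + ‖x‖ ^ 2 ≠ 0 := fun x => by positivity
  fun_prop (disch := exact h _)

/-- The parallelogram law fixes the sum of the two outer denominators, and the harmonic–arithmetic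
mean inequality bounds their reciprocals below. This gives the quadratic bound; boundedness of the
profile gives the constant one. -/
theorem bump_second_difference_le [InnerProductSpace ℝ E] (x y : E) :
    bump (x + y) + bump (x - y) - 2 * bump x ≤ 34 * min (‖y‖ ^ 2) 1 := by
  have hpar := parallelogram_law_with_norm ℝ x y
  have hS : 0 < 1 + ‖x + y‖ ^ 2 := by positivity
  have hT : 0 < 1 + ‖x - y‖ ^ 2 := by positivity
  have hP : 0 < 1 + ‖x‖ ^ 2 := by positivity
  have hx0 := sq_nonneg ‖x‖
  have hy0 := sq_nonneg ‖y‖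
  have hsum : (1 + ‖x + y‖ ^ 2) + (1 + ‖x - y‖ ^ 2) = 2 * (1 + ‖x‖ ^ 2) + 2 * ‖y‖ ^ 2 := by
    nlinarith
  have hS' : 0 < 1 / (1 + ‖x + y‖ ^ 2) := by positivity
  have hT' : 0 < 1 / (1 + ‖x - y‖ ^ 2) := by positivity
  have hP1 : 1 / (1 + ‖x‖ ^ 2) ≤ 1 := by
    rw [div_le_one hP]
    linarith
  have hharm : 2 / (1 + ‖x‖ ^ 2 + ‖y‖ ^ 2) ≤
      1 / (1 + ‖x + y‖ ^ 2) + 1 / (1 + ‖x - y‖ ^ 2) := by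
    have hA : 1 + ‖x‖ ^ 2 + ‖y‖ ^ 2 = ((1 + ‖x + y‖ ^ 2) + (1 + ‖x - y‖ ^ 2)) / 2 := by linarith
    rw [hA, div_add_div _ _ hS.ne' hT.ne', div_le_div_iff₀ (by positivity) (by positivity)]
    nlinarith [sq_nonneg ((1 + ‖x + y‖ ^ 2) - (1 + ‖x - y‖ ^ 2))]
  have hdiff : 1 / (1 + ‖x‖ ^ 2) - ‖y‖ ^ 2 ≤ 1 / (1 + ‖x‖ ^ 2 + ‖y‖ ^ 2) := by
    rw [div_sub' hP.ne', div_le_div_iff₀ hP (by positivity)]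
    nlinarith [mul_nonneg hx0 hy0, mul_nonneg hx0 hx0, mul_nonneg hy0 hy0,
      mul_nonneg (mul_nonneg hx0 hx0) hy0, mul_nonneg (mul_nonneg hx0 hy0) hy0]
  have htwo : 2 / (1 + ‖x‖ ^ 2 + ‖y‖ ^ 2) = 2 * (1 / (1 + ‖x‖ ^ 2 + ‖y‖ ^ 2)) := by ring
  have h1 : bump (x + y) + bump (x - y) - 2 * bump x ≤ 34 * ‖y‖ ^ 2 := by
    unfold bump
    linarith
  have h2 : bump (x + y) + bump (x - y) - 2 * bump x ≤ 34 * 1 := by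
    unfold bump
    linarith
  rcases le_total (‖y‖ ^ 2) 1 with h | h
  · rwa [min_eq_left h]
  · rwa [min_eq_right h]

end Bump

/-! ### Integrability of the Lévy weight -/

/-- The Lévy-type weight `min(|y|², 1) / |y|^{N+2s}`. -/
def levyWeight (N : ℕ) (s : ℝ) (y : EuclideanSpace ℝ (Fin N)) : ℝ :=
  min (‖y‖ ^ 2) 1 / ‖y‖ ^ ((N : ℝ) + 2 * s)

theorem levyWeight_nonneg (N : ℕ) (s : ℝ) (y : EuclideanSpace ℝ (Fin N)) :
    0 ≤ levyWeight N s y := by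
  unfold levyWeight
  positivity

/-- In polar coordinates the density is r^(1-2s) near 0, integrable since s < 1, and r^(-1-2s) at
infinity, integrable since s > 0. -/
theorem integrable_levyWeight {N : ℕ} (hN : 1 ≤ N) {s : ℝ} (hs0 : 0 < s) (hs1 : s < 1) :
    Integrable (levyWeight N s) := by
  have : Nonempty (Fin N) := ⟨⟨0, hN⟩⟩
  have hrad := integrable_fun_norm_addHaar (volume : Measure (EuclideanSpace ℝ (Fin N)))
    (f := fun r : ℝ => min (r ^ 2) 1 / r ^ ((N : ℝ) + 2 * s))
  refine hrad.2 ?_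
  rw [finrank_euclideanSpace_fin]
  have hpow : ∀ r : ℝ, 0 < r → ∀ b : ℝ,
      r ^ (N - 1) • (r ^ b / r ^ ((N : ℝ) + 2 * s)) = r ^ (b - 1 - 2 * s) := by
    intro r hr b
    rw [← Real.rpow_natCast, smul_eq_mul, ← Real.rpow_sub hr, ← Real.rpow_add hr,
      Nat.cast_sub hN]
    congr 1
    push_cast
    ring
  rw [← Ioc_union_Ioi_eq_Ioi (zero_le_one' ℝ)]
  refine IntegrableOn.union ?_ ?_
  · have h := (intervalIntegral.intervalIntegrable_rpow' (a := 0) (b := 1)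
      (r := 2 - 1 - 2 * s) (by linarith))
    rw [intervalIntegrable_iff_integrableOn_Ioc_of_le zero_le_one] at h
    refine h.congr_fun (fun r hr => ?_) measurableSet_Ioc
    have hr2 : r ^ 2 ≤ 1 := by nlinarith [hr.1, hr.2]
    simp only [min_eq_left hr2]
    rw [← hpow r hr.1 2, Real.rpow_two]
  · have h := integrableOn_Ioi_rpow_of_lt (a := 0 - 1 - 2 * s) (c := 1) (by linarith) one_pos
    refine h.congr_fun (fun r hr => ?_) measurableSet_Ioi
    have hr1 : 1 < r := hr
    have hr2 : 1 ≤ r ^ 2 := by nlinarith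
    simp only [min_eq_right hr2]
    rw [← hpow r (by linarith) 0, Real.rpow_zero]

/-! ### Increments and second derivatives along coordinate lines -/

variable {k : ℕ} {N : Fin k → ℕ}

theorem norm_basisVec (j : Fin ((∑ i, N i) + 1)) : ‖basisVec N j‖ = 1 := by
  simp [basisVec]

theorem groupIndex_injective (i : Fin k) : Function.Injective (groupIndex N i) := by
  intro j j' h
  have h1 := finSigmaFinEquiv.injective (Fin.castSucc_injective _ h)
  simpa using h1

theorem norm_increment (i : Fin k) (y : EuclideanSpace ℝ (Fin (N i))) :
    ‖increment N i y‖ = ‖y‖ := by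
  have ho : Orthonormal ℝ fun j => basisVec N (groupIndex N i j) := by
    have := (EuclideanSpace.basisFun (Fin ((∑ i, N i) + 1)) ℝ).orthonormal.comp _
      (groupIndex_injective (N := N) i)
    simpa [Function.comp_def, basisVec] using this
  have h := ho.inner_sum (fun j => y j) (fun j => y j) Finset.univ
  have h2 : ‖increment N i y‖ ^ 2 = ‖y‖ ^ 2 := by
    rw [← real_inner_self_eq_norm_sq, increment, h, EuclideanSpace.real_norm_sq_eq]
    simp [sq]
  exact (sq_eq_sq₀ (norm_nonneg _) (norm_nonneg _)).1 h2

theorem eventually_add_smul_mem {Ω : Set (Space N)} (hΩ : IsOpen Ω) {p : Space N} (hp : p ∈ Ω)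
    (e : Space N) : ∀ᶠ h in 𝓝 (0 : ℝ), p + h • e ∈ Ω := by
  have hcont : Continuous fun h : ℝ => p + h • e := by fun_prop
  exact hcont.continuousAt.eventually_mem (by simpa using hΩ.mem_nhds hp)

theorem TwiceDiffInVar.hasDerivAt {j : Fin ((∑ i, N i) + 1)} {u : Space N → ℝ}
    {Ω : Set (Space N)} (hu : TwiceDiffInVar N j u Ω) {p : Space N} {h : ℝ}
    (hp : p + h • basisVec N j ∈ Ω) :
    HasDerivAt (fun t : ℝ => u (p + t • basisVec N j))
      (partialDeriv N j u (p + h • basisVec N j)) h := by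
  have h1 : HasDerivAt (fun t : ℝ => u (p + h • basisVec N j + t • basisVec N j))
      (partialDeriv N j u (p + h • basisVec N j)) (h - h) := by
    rw [sub_self]
    exact (hu _ hp).1.hasDerivAt
  have h2 := HasDerivAt.comp (h₂ := fun t : ℝ => u (p + h • basisVec N j + t • basisVec N j))
    (h := fun t : ℝ => t - h) h h1 ((hasDerivAt_id h).sub_const h)
  rw [mul_one] at h2
  refine h2.congr_of_eventuallyEq (Eventually.of_forall fun t => ?_)
  simp only [Function.comp]
  congr 1
  module

/-- A bound on the difference of two second differences of `u` in the direction `e_j` bounds the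
difference of the second derivatives. -/
theorem TwiceDiffInVar.partialDeriv_sub_le {j : Fin ((∑ i, N i) + 1)} {u : Space N → ℝ}
    {Ω : Set (Space N)} (hΩ : IsOpen Ω) (hu : TwiceDiffInVar N j u Ω) {p q : Space N}
    (hp : p ∈ Ω) (hq : q ∈ Ω) {c : ℝ}
    (hc : ∀ᶠ h in 𝓝 (0 : ℝ),
      (u (p + h • basisVec N j) + u (p - h • basisVec N j) - 2 * u p) -
        (u (q + h • basisVec N j) + u (q - h • basisVec N j) - 2 * u q) ≤ c * h ^ 2) :
    partialDeriv N j (partialDeriv N j u) p - partialDeriv N j (partialDeriv N j u) q ≤ c := by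
  refine second_deriv_le_of_second_difference_le
    (g := fun h => u (p + h • basisVec N j) - u (q + h • basisVec N j))
    (g' := fun h => partialDeriv N j u (p + h • basisVec N j) -
      partialDeriv N j u (q + h • basisVec N j)) ?_ ?_ ?_
  · filter_upwards [eventually_add_smul_mem hΩ hp (basisVec N j),
      eventually_add_smul_mem hΩ hq (basisVec N j)] with h h1 h2
    exact (hu.hasDerivAt h1).sub (hu.hasDerivAt h2)
  · exact (hu p hp).2.hasDerivAt.sub (hu q hq).2.hasDerivAt
  · filter_upwards [hc] with h hh
    simp only [neg_smul, ← sub_eq_add_neg, zero_smul, add_zero]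
    linarith

/-! ### Comparing Laplacians at two points -/

open Classical in
/-- The size of the `s`-Laplacian in the `i`-th group of variables on functions whose second
differences are bounded by `min(|y|², 1)`. -/
def laplacianBound (N : Fin k → ℕ) (i : Fin k) (s : ℝ) : ℝ :=
  if s = 1 then N i else fracConst (N i) s * ∫ y, levyWeight (N i) s y

theorem fracConst_nonneg (n : ℕ) {s : ℝ} (hs : 0 < s) : 0 ≤ fracConst n s := by
  unfold fracConst
  have : 0 < Real.Gamma (s + (n : ℝ) / 2) := Real.Gamma_pos_of_pos (by positivity)
  positivity

theorem laplacianBound_nonneg (i : Fin k) {s : ℝ} (hs : 0 < s) : 0 ≤ laplacianBound N i s := by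
  unfold laplacianBound
  split_ifs
  · positivity
  · exact mul_nonneg (fracConst_nonneg _ hs) (integral_nonneg fun y => levyWeight_nonneg _ _ y)

theorem neg_laplacianBound_le_groupLaplacian_sub {i : Fin k} (hN : 1 ≤ N i) {s : ℝ} (hs0 : 0 < s)
    (hs1 : s ≤ 1) {u : Space N → ℝ} {Ω : Set (Space N)} (hΩ : IsOpen Ω)
    (hu : GroupLaplacianDefinedOn N i s u Ω) {p q : Space N} (hp : p ∈ Ω) (hq : q ∈ Ω) {c : ℝ}
    (hc0 : 0 ≤ c)
    (hc : ∀ y : Space N, (u (p + y) + u (p - y) - 2 * u p) - (u (q + y) + u (q - y) - 2 * u q) ≤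
      c * min (‖y‖ ^ 2) 1) :
    -(c * laplacianBound N i s) ≤ groupLaplacian N i s u p - groupLaplacian N i s u q := by
  unfold groupLaplacian laplacianBound
  split_ifs with h1
  · have hj : ∀ j, partialDeriv N (groupIndex N i j) (partialDeriv N (groupIndex N i j) u) p -
        partialDeriv N (groupIndex N i j) (partialDeriv N (groupIndex N i j) u) q ≤ c := by
      intro j
      refine (hu.1 h1 j).partialDeriv_sub_le hΩ hp hq (Eventually.of_forall fun h => ?_)
      refine (hc _).trans (mul_le_mul_of_nonneg_left ((min_le_left _ _).trans ?_) hc0)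
      rw [norm_smul, norm_basisVec, mul_one, Real.norm_eq_abs, sq_abs]
    have hsum := Finset.sum_le_sum fun j (_ : j ∈ Finset.univ) => hj j
    rw [Finset.sum_sub_distrib, Finset.sum_const, Finset.card_univ, Fintype.card_fin,
      nsmul_eq_mul] at hsum
    linarith
  · have hip := hu.2 h1 p hp
    have hiq := hu.2 h1 q hq
    have hw := integrable_levyWeight hN hs0 (lt_of_le_of_ne hs1 h1)
    have hle : ∫ y, -c * levyWeight (N i) s y ≤
        ∫ y, (fracIntegrand N i s u p y - fracIntegrand N i s u q y) := by
      refine integral_mono (hw.const_mul _) (hip.sub hiq) fun y => ?_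
      have hy := hc (increment N i y)
      rw [norm_increment] at hy
      unfold levyWeight fracIntegrand
      rw [← sub_div, mul_div_assoc']
      refine div_le_div_of_nonneg_right ?_ (by positivity)
      linarith
    rw [integral_const_mul, integral_sub hip hiq] at hle
    have := mul_le_mul_of_nonneg_left hle (fracConst_nonneg (N i) hs0)
    linarith

/-! ### Maximum principle for the half increment -/

variable {s a : Fin k → ℝ} {aLast : ℝ} {u f : Space N → ℝ}

/-- At a point `(x, t)` where the half increment `(u(x + t e_n) - u(x - t e_n)) / 2` minus the
barrier `M bump(x - x₀) + B t (1 - t)` is maximal, the equation bounds `B`. -/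
theorem IsSolution.barrier_coefficient_le (hN : ∀ i, 1 ≤ N i) (hs : ∀ i, 0 < s i ∧ s i ≤ 1)
    (ha : ∀ i, 0 ≤ a i) (haLast : 0 < aLast) {Ω : Set (Space N)} (hΩ : IsOpen Ω)
    (hu : IsSolution N s a aLast u f Ω) {M K B : ℝ} (hM : 0 ≤ M) (hf : ∀ x ∈ Ω, |f x| ≤ K)
    (x₀ x : Space N) {t : ℝ} (hp : x + t • basisVec N (Fin.last _) ∈ Ω)
    (hq : x - t • basisVec N (Fin.last _) ∈ Ω)
    (hspace : ∀ y : Space N,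
      (u (y + t • basisVec N (Fin.last _)) - u (y - t • basisVec N (Fin.last _))) / 2 -
          M * bump (y - x₀) ≤
        (u (x + t • basisVec N (Fin.last _)) - u (x - t • basisVec N (Fin.last _))) / 2 -
          M * bump (x - x₀))
    (htime : ∀ᶠ r in 𝓝 t,
      (u (x + r • basisVec N (Fin.last _)) - u (x - r • basisVec N (Fin.last _))) / 2 -
          B * (r * (1 - r)) ≤
        (u (x + t • basisVec N (Fin.last _)) - u (x - t • basisVec N (Fin.last _))) / 2 -
          B * (t * (1 - t))) :
    2 * aLast * B ≤ K + 34 * M * ∑ i, a i * laplacianBound N i (s i) := by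
  set e := basisVec N (Fin.last (∑ i, N i)) with he
  have hlap : ∀ i, -(68 * M * (a i * laplacianBound N i (s i))) ≤
      a i * groupLaplacian N i (s i) u (x + t • e) -
        a i * groupLaplacian N i (s i) u (x - t • e) := by
    intro i
    -- If a_i = 0, the Laplacian need not be computable, but its term vanishes.
    rcases (ha i).eq_or_lt with h0 | hpos
    · simp [← h0]
    · have h := neg_laplacianBound_le_groupLaplacian_sub (hN i) (hs i).1 (hs i).2 hΩ
        (hu.groupDefined i hpos.ne') hp hq (c := 68 * M) (by positivity) (fun y => by
          have h1 := hspace (x + y)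
          have h2 := hspace (x - y)
          have h3 := mul_le_mul_of_nonneg_left (bump_second_difference_le (x - x₀) y) hM
          rw [show x + y + t • e = x + t • e + y by abel,
            show x + y - t • e = x - t • e + y by abel,
            show x + y - x₀ = x - x₀ + y by abel] at h1
          rw [show x - y + t • e = x + t • e - y by abel,
            show x - y - t • e = x - t • e - y by abel,
            show x - y - x₀ = x - x₀ - y by abel] at h2
          linarith)
      have := mul_le_mul_of_nonneg_left h hpos.le
      linarith
  have hlast : partialDeriv N (Fin.last _) (partialDeriv N (Fin.last _) u) (x + t • e) -
      partialDeriv N (Fin.last _) (partialDeriv N (Fin.last _) u) (x - t • e) ≤ -(4 * B) := by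
    -- Moving t by ±h moves p and q along e_n in opposite directions; t(1 - t) has second difference
    -- -2h², doubled by the factor 1/2 in v.
    refine hu.lastDefined.partialDeriv_sub_le hΩ hp hq ?_
    have hadd : Tendsto (fun h : ℝ => t + h) (𝓝 0) (𝓝 t) := by
      simpa using (continuous_const_add t).tendsto 0
    have hsub : Tendsto (fun h : ℝ => t - h) (𝓝 0) (𝓝 t) := by
      simpa using (continuous_sub_left t).tendsto 0
    filter_upwards [hadd.eventually htime, hsub.eventually htime] with h h1 h2
    rw [← he]
    rw [show x + (t + h) • e = x + t • e + h • e by module,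
      show x - (t + h) • e = x - t • e - h • e by module] at h1
    rw [show x + (t - h) • e = x + t • e - h • e by module,
      show x - (t - h) • e = x - t • e + h • e by module] at h2
    linarith
  have hsum := Finset.sum_le_sum fun i (_ : i ∈ Finset.univ) => hlap i
  rw [Finset.sum_sub_distrib, Finset.sum_neg_distrib, ← Finset.mul_sum] at hsum
  have e1 := hu.equation _ hp
  have e2 := hu.equation _ hq
  unfold opL at e1 e2
  have f1 := abs_le.1 (hf _ hp)
  have f2 := abs_le.1 (hf _ hq)
  have := mul_le_mul_of_nonneg_left hlast haLast.le
  linarith [f1.2, f2.1]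

/-- The constant of the interior Lipschitz estimate. -/
def lipschitzConst (N : Fin k → ℕ) (s a : Fin k → ℝ) (aLast : ℝ) : ℝ :=
  (1 + 34 * ∑ i, a i * laplacianBound N i (s i)) / (2 * aLast) + 6

theorem six_le_lipschitzConst (hs : ∀ i, 0 < s i ∧ s i ≤ 1) (ha : ∀ i, 0 ≤ a i)
    (haLast : 0 < aLast) : 6 ≤ lipschitzConst N s a aLast := by
  have : 0 ≤ ∑ i, a i * laplacianBound N i (s i) :=
    Finset.sum_nonneg fun i _ => mul_nonneg (ha i) (laplacianBound_nonneg i (hs i).1)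
  unfold lipschitzConst
  have : 0 ≤ (1 + 34 * ∑ i, a i * laplacianBound N i (s i)) / (2 * aLast) := by positivity
  linarith

theorem IsSolution.half_increment_le (hN : ∀ i, 1 ≤ N i) (hs : ∀ i, 0 < s i ∧ s i ≤ 1)
    (ha : ∀ i, 0 ≤ a i) (haLast : 0 < aLast)
    (hu : IsSolution N s a aLast u f (Metric.ball 0 1)) {M K : ℝ} (hM : ∀ x, |u x| ≤ M)
    (hf : ∀ x ∈ Metric.ball (0 : Space N) 1, |f x| ≤ K) {x₀ : Space N}
    (hx₀ : x₀ ∈ Metric.ball (0 : Space N) (1 / 2)) {t : ℝ} (ht : t ∈ Icc (0 : ℝ) (1 / 4)) :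
    (u (x₀ + t • basisVec N (Fin.last _)) - u (x₀ - t • basisVec N (Fin.last _))) / 2 ≤
      lipschitzConst N s a aLast * (K + M) * (t * (1 - t)) := by
  set e := basisVec N (Fin.last (∑ i, N i)) with he
  set B := lipschitzConst N s a aLast * (K + M) with hB
  have hM0 : 0 ≤ M := (abs_nonneg _).trans (hM 0)
  have hK0 : 0 ≤ K := (abs_nonneg _).trans (hf 0 (by simp))
  have hC := six_le_lipschitzConst (N := N) hs ha haLast
  -- At t = 1/4 the barrier is 3B/16, which this makes at least M.
  have hB6 : 6 * M ≤ B := by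
    rw [hB]
    nlinarith
  have he1 : ‖e‖ = 1 := norm_basisVec _
  have hmem : ∀ x ∈ Metric.closedBall x₀ (1 / 4), ∀ r : ℝ, |r| ≤ 1 / 4 →
      x + r • e ∈ Metric.ball (0 : Space N) 1 := by
    intro x hx r hr
    rw [mem_closedBall_iff_norm] at hx
    rw [mem_ball_zero_iff] at hx₀ ⊢
    have h1 : ‖r • e‖ ≤ 1 / 4 := by rwa [norm_smul, he1, mul_one]
    calc ‖x + r • e‖ = ‖x₀ + (x - x₀) + r • e‖ := by congr 1; abel
      _ ≤ ‖x₀‖ + ‖x - x₀‖ + ‖r • e‖ := norm_add₃_le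
      _ < 1 := by linarith
  have hmem' : ∀ x ∈ Metric.closedBall x₀ (1 / 4), ∀ r : ℝ, |r| ≤ 1 / 4 →
      x - r • e ∈ Metric.ball (0 : Space N) 1 := by
    intro x hx r hr
    have := hmem x hx (-r) (by rwa [abs_neg])
    rwa [neg_smul, ← sub_eq_add_neg] at this
  have habs : ∀ r ∈ Icc (0 : ℝ) (1 / 4), |r| ≤ 1 / 4 := fun r hr =>
    abs_le.2 ⟨by linarith [hr.1], hr.2⟩
  let w : Space N × ℝ → ℝ := fun z => (u (z.1 + z.2 • e) - u (z.1 - z.2 • e)) / 2 -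
    M * bump (z.1 - x₀) - B * (z.2 * (1 - z.2))
  have hw : ContinuousOn w (Metric.closedBall x₀ (1 / 4) ×ˢ Icc (0 : ℝ) (1 / 4)) := by
    have h1 : ContinuousOn (fun z : Space N × ℝ => u (z.1 + z.2 • e))
        (Metric.closedBall x₀ (1 / 4) ×ˢ Icc (0 : ℝ) (1 / 4)) :=
      hu.continuousOn.comp (by fun_prop) fun z hz => hmem _ hz.1 _ (habs _ hz.2)
    have h2 : ContinuousOn (fun z : Space N × ℝ => u (z.1 - z.2 • e))
        (Metric.closedBall x₀ (1 / 4) ×ˢ Icc (0 : ℝ) (1 / 4)) :=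
      hu.continuousOn.comp (by fun_prop) fun z hz => hmem' _ hz.1 _ (habs _ hz.2)
    have h3 : Continuous fun z : Space N × ℝ => bump (z.1 - x₀) :=
      continuous_bump.comp (by fun_prop)
    have h4 : Continuous fun z : Space N × ℝ => B * (z.2 * (1 - z.2)) := by fun_prop
    exact (((h1.sub h2).div_const 2).sub (h3.const_mul M).continuousOn).sub h4.continuousOn
  have hv : ∀ (x : Space N) (r : ℝ), (u (x + r • e) - u (x - r • e)) / 2 ≤ M := fun x r => by
    linarith [(abs_le.1 (hM (x + r • e))).2, (abs_le.1 (hM (x - r • e))).1]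
  have hB0 : 0 ≤ B := by linarith
  -- Off the ball of radius 1/4 the profile already dominates v ≤ M, so a positive maximum on the
  -- cylinder is a maximum over all x.
  have hfar : ∀ (x : Space N) (r : ℝ), r ∈ Icc (0 : ℝ) (1 / 4) → 1 / 4 ≤ ‖x - x₀‖ →
      w (x, r) ≤ 0 := by
    intro x r hr hx
    have h1 := mul_le_mul_of_nonneg_left (one_le_bump hx) hM0
    have h2 : 0 ≤ B * (r * (1 - r)) :=
      mul_nonneg hB0 (mul_nonneg hr.1 (by linarith [hr.2]))
    simp only [w]
    linarith [hv x r]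
  obtain ⟨⟨x, r⟩, ⟨hx, hr⟩, hmax⟩ :=
    ((isCompact_closedBall x₀ (1 / 4)).prod isCompact_Icc).exists_isMaxOn
      ⟨(x₀, 0), by simp⟩ hw
  dsimp only at hx hr
  have hwx : w (x₀, t) ≤ w (x, r) := hmax ⟨by simp, ht⟩
  suffices hle : w (x, r) ≤ 0 by
    have := hwx.trans hle
    simp only [w, sub_self, bump_zero] at this
    linarith
  by_contra! hpos
  have hxlt : ‖x - x₀‖ < 1 / 4 := by
    by_contra! h
    exact absurd (hfar x r hr h) (not_le.2 hpos)
  have hbx := mul_nonneg hM0 (bump_nonneg (x - x₀))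
  have hr0 : 0 < r := by
    refine hr.1.lt_of_ne' fun h => ?_
    simp only [w, h, zero_smul, add_zero, sub_zero, sub_self, zero_mul, mul_zero, zero_div]
      at hpos
    linarith
  have hr1 : r < 1 / 4 := by
    refine hr.2.lt_of_ne fun h => ?_
    have h1 := hv x r
    simp only [w] at hpos
    rw [h] at h1 hpos
    linarith
  -- This makes the final contradiction strict; with K = M = 0 both sides would be 0.
  have hMpos : 0 < M := by
    have h1 := hv x r
    have h2 : 0 ≤ B * (r * (1 - r)) := mul_nonneg hB0 (mul_nonneg hr0.le (by linarith))
    simp only [w] at hpos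
    linarith
  have key := hu.barrier_coefficient_le hN hs ha haLast Metric.isOpen_ball hM0 hf x₀ x (B := B)
    (hmem x hx r (habs r hr)) (hmem' x hx r (habs r hr)) (fun y => by
      have h : w (y, r) ≤ w (x, r) := by
        by_cases hy : y ∈ Metric.closedBall x₀ (1 / 4)
        · exact hmax ⟨hy, hr⟩
        · rw [mem_closedBall_iff_norm, not_le] at hy
          exact (hfar y r hr hy.le).trans hpos.le
      simp only [w] at h
      linarith) (by
      filter_upwards [Icc_mem_nhds hr0 hr1] with r' hr'
      have h : w (x, r') ≤ w (x, r) := hmax ⟨hx, hr'⟩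
      simp only [w] at h
      linarith)
  have hΛ : 0 ≤ ∑ i, a i * laplacianBound N i (s i) :=
    Finset.sum_nonneg fun i _ => mul_nonneg (ha i) (laplacianBound_nonneg i (hs i).1)
  have hval : 2 * aLast * B =
      (1 + 34 * ∑ i, a i * laplacianBound N i (s i)) * (K + M) + 12 * aLast * (K + M) := by
    rw [hB, lipschitzConst]
    field_simp
    ring
  have h1 : 0 < aLast * (K + M) := mul_pos haLast (by linarith)
  have h2 := mul_nonneg hΛ hK0
  nlinarith

/-! ### Sign symmetry and the derivative bound -/

theorem partialDeriv_neg (j : Fin ((∑ i, N i) + 1)) (u : Space N → ℝ) :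
    partialDeriv N j (fun x => -u x) = fun x => -partialDeriv N j u x := by
  funext x
  exact deriv.fun_neg

theorem fracIntegrand_neg (i : Fin k) (s : ℝ) (u : Space N → ℝ) (x : Space N) :
    fracIntegrand N i s (fun x => -u x) x = fun y => -fracIntegrand N i s u x y := by
  funext y
  unfold fracIntegrand
  ring

theorem TwiceDiffInVar.neg {j : Fin ((∑ i, N i) + 1)} {Ω : Set (Space N)}
    (hu : TwiceDiffInVar N j u Ω) : TwiceDiffInVar N j (fun x => -u x) Ω := by
  intro x hx
  rw [partialDeriv_neg]
  exact ⟨DifferentiableAt.fun_neg (hu x hx).1, DifferentiableAt.fun_neg (hu x hx).2⟩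

theorem groupLaplacian_neg (i : Fin k) (s : ℝ) (u : Space N → ℝ) (x : Space N) :
    groupLaplacian N i s (fun x => -u x) x = -groupLaplacian N i s u x := by
  unfold groupLaplacian
  split_ifs
  · simp only [partialDeriv_neg, Finset.sum_neg_distrib]
  · rw [fracIntegrand_neg, integral_neg, mul_neg]

theorem IsSolution.neg {Ω : Set (Space N)} (hu : IsSolution N s a aLast u f Ω) :
    IsSolution N s a aLast (fun x => -u x) (fun x => -f x) Ω where
  continuousOn := hu.continuousOn.fun_neg
  groupDefined i hi := ⟨fun h j => ((hu.groupDefined i hi).1 h j).neg, fun h x hx => by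
    rw [fracIntegrand_neg]
    exact ((hu.groupDefined i hi).2 h x hx).fun_neg⟩
  lastDefined := hu.lastDefined.neg
  equation x hx := by
    rw [← hu.equation x hx]
    unfold opL
    simp only [groupLaplacian_neg, partialDeriv_neg, mul_neg, Finset.sum_neg_distrib]
    ring

theorem IsSolution.partialDeriv_last_le (hN : ∀ i, 1 ≤ N i) (hs : ∀ i, 0 < s i ∧ s i ≤ 1)
    (ha : ∀ i, 0 ≤ a i) (haLast : 0 < aLast)
    (hu : IsSolution N s a aLast u f (Metric.ball 0 1)) {M K : ℝ} (hM : ∀ x, |u x| ≤ M)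
    (hf : ∀ x ∈ Metric.ball (0 : Space N) 1, |f x| ≤ K) {x : Space N}
    (hx : x ∈ Metric.ball (0 : Space N) (1 / 2)) :
    partialDeriv N (Fin.last _) u x ≤ lipschitzConst N s a aLast * (K + M) := by
  set B := lipschitzConst N s a aLast * (K + M) with hB
  have hM0 : 0 ≤ M := (abs_nonneg _).trans (hM 0)
  have hK0 : 0 ≤ K := (abs_nonneg _).trans (hf 0 (by simp))
  have hB0 : 0 ≤ B :=
    mul_nonneg (by linarith [six_le_lipschitzConst (N := N) hs ha haLast]) (by linarith)
  have hx1 : x ∈ Metric.ball (0 : Space N) 1 := Metric.ball_subset_ball (by norm_num) hx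
  have hd : HasDerivAt (fun t : ℝ => u (x + t • basisVec N (Fin.last _)))
      (partialDeriv N (Fin.last _) u x) 0 := (hu.lastDefined x hx1).1.hasDerivAt
  have hd' : HasDerivAt (fun t : ℝ => u (x + t • basisVec N (Fin.last _)))
      (partialDeriv N (Fin.last _) u x) (-0) := by rwa [neg_zero]
  have hD : HasDerivAt (fun t : ℝ => (u (x + t • basisVec N (Fin.last _)) -
      u (x + (-t) • basisVec N (Fin.last _))) / 2) (partialDeriv N (Fin.last _) u x) 0 := by
    refine ((hd.sub (hd'.comp 0 (hasDerivAt_neg 0))).div_const 2).congr_deriv ?_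
    ring
  have hlim := hD.tendsto_slope_zero_right
  refine le_of_tendsto hlim ?_
  filter_upwards [Ioo_mem_nhdsGT (show (0 : ℝ) < 1 / 4 by norm_num)] with t ht
  have h := hu.half_increment_le hN hs ha haLast hM hf hx (Ioo_subset_Icc_self ht)
  simp only [zero_add, neg_zero, sub_self, zero_div, sub_zero, smul_eq_mul, neg_smul,
    ← sub_eq_add_neg]
  rw [inv_mul_le_iff₀ ht.1]
  have : B * (t * (1 - t)) ≤ t * B := by nlinarith [mul_nonneg hB0 (sq_nonneg t)]
  exact h.trans this

theorem abs_le_toReal_supNorm {g : Space N → ℝ} {Ω : Set (Space N)} (hg : supNorm g Ω ≠ ⊤)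
    {x : Space N} (hx : x ∈ Ω) : |g x| ≤ (supNorm g Ω).toReal := by
  have h : ‖g x‖ₑ ≤ supNorm g Ω := le_iSup₂ (f := fun x (_ : x ∈ Ω) => ‖g x‖ₑ) x hx
  simpa using ENNReal.toReal_mono hg h

end AnisotropicNonlocal

end

theorem corollary1p2 {k : ℕ} (N : Fin k → ℕ) (hN : ∀ i, 1 ≤ N i)
    (s : Fin k → ℝ) (hs : ∀ i, 0 < s i ∧ s i ≤ 1)
    (a : Fin k → ℝ) (ha : ∀ i, 0 ≤ a i) (aLast : ℝ) (haLast : 0 < aLast) :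
    ∃ C : ℝ, 0 < C ∧
      ∀ u f : AnisotropicNonlocal.Space N → ℝ,
        AnisotropicNonlocal.IsSolution N s a aLast u f (Metric.ball 0 1) →
        AnisotropicNonlocal.supNorm
            (AnisotropicNonlocal.partialDeriv N (Fin.last _) u) (Metric.ball 0 (1 / 2)) ≤
          ENNReal.ofReal C *
            (AnisotropicNonlocal.supNorm f (Metric.ball 0 1) +
              AnisotropicNonlocal.supNorm u Set.univ) := by
  have hC : 0 < AnisotropicNonlocal.lipschitzConst N s a aLast :=
    lt_of_lt_of_le (by norm_num) (AnisotropicNonlocal.six_le_lipschitzConst hs ha haLast)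
  refine ⟨AnisotropicNonlocal.lipschitzConst N s a aLast, hC, fun u f hu => ?_⟩
  set K := AnisotropicNonlocal.supNorm f (Metric.ball 0 1)
  set M := AnisotropicNonlocal.supNorm u Set.univ
  -- An infinite right-hand side is trivial since C > 0; otherwise all bounds are real.
  by_cases htop : K + M = ⊤
  · rw [htop, ENNReal.mul_top (by simpa using hC)]
    exact le_top
  obtain ⟨hK, hM⟩ := ENNReal.add_ne_top.1 htop
  have hfK : ∀ x ∈ Metric.ball 0 1, |f x| ≤ K.toReal := fun x hx =>
    AnisotropicNonlocal.abs_le_toReal_supNorm hK hx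
  have huM : ∀ x, |u x| ≤ M.toReal := fun x =>
    AnisotropicNonlocal.abs_le_toReal_supNorm hM (Set.mem_univ x)
  refine iSup₂_le fun x hx => ?_
  have h1 := hu.partialDeriv_last_le hN hs ha haLast huM hfK hx
  have h2 := hu.neg.partialDeriv_last_le hN hs ha haLast (by simpa using huM)
    (by simpa using hfK) hx
  rw [AnisotropicNonlocal.partialDeriv_neg] at h2
  rw [← ENNReal.ofReal_toReal htop, ← ENNReal.ofReal_mul hC.le, ENNReal.toReal_add hK hM,
    ← ofReal_norm, Real.norm_eq_abs]
  exact ENNReal.ofReal_le_ofReal (abs_le.2 ⟨by linarith, h1⟩)
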